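/- **Conventions.** A *signed permutation* in $\mathcal W_n$ is a bijection $w:\mathbb Z\to\mathbb Z$ with $w(-i)=-w(i)$ for all $i$ and $w(m)=m$ for all $m>n$; we write $\bar x=-x$. A *corner position* of $w$ is a pair of integers $(p,q)$ with $p\ge 1$ such that the box $(a,b)=(q-1,\bar p)$ satisfies $w(b)>a\ge w(b+1)$ and $w^{-1}(a)>b\ge w^{-1}(a+1)$. Let $r_w(p,q)=\#\{i\ge p: w(i)\le \bar q\}$. The *corner set* $\mathscr C(w)$ is the set of triples $(k,p,q)$ with $(p,q)$ a corner position and $k=r_w(p,q)$. Write $(p,q)<(p',q')$ if $p>p'$ and $q<q'$; the *NE path* $\mathscr N\!e(w)$ is the set of corner positions that are minimal among all corner positions. A corner $(k,p,q)\in\mathscr C(w)$ is *unessential* if there are $(p_1,q_1),(p_2,q_2),(p_3,q_3)\in\mathscr N\!e(w)$ with $p_1=p$ and $q_1<q<0$; $p_2>0$ and $q_2=\bar q+1$; $(p_3,q_3)<(p,q)$. The set of these is $\mathscr U(w)$. **Theta-triples.** A *theta-triple* $\tau=(\mathbf k,\mathbf p,\mathbf q)$ consists of $s$-tuples of integers ($s\ge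 0$) $0<k_1<\dots<k_s$, $p_1\ge\dots\ge p_s>0$, $q_1\ge\dots\ge q_s$ such that, with $k_0=0$, $q_0=+\infty$, with $a\in\{1,\dots,s+1\}$ defined by $q_i>0$ for $i<a$ and $q_i<0$ for $i\ge a$, and with $R(i)$, for $a\le i\le s$, the unique index satisfying $q_{R(i)}>-q_i>q_{R(i)+1}$: - A1. $q_i\ne0$ for all $i$; A2. $q_i\ne -q_j$ for $i\ne j$; A3. if $s\ge1$ and $q_s<0$ then $p_s>1$; - B1. $(p_i-p_{i+1})+(q_i-q_{i+1})>k_{i+1}-k_i$ for $1\le i<a-1$; - B2. $(p_i-p_{i+1})+(q_i-q_{i+1})>(k_{i+1}-k_i)+(k_{R(i)}-k_{R(i+1)})$ for $a\le i<s$; - B3. $p_s+q_s+k_s>k_{R(s)}+1$ if $a\le s$; - C1. $-q_i\ge k_i-k_{R(i)}$ for $a\le i\le s$; - C2. $-q_i\ge q_j+k_j-k_{R(i)}$ for all $a\le i\le s$ and all $j$ with $R(i)<j<a$. **The permutation $w(\tau)$.** Its values at positions $1,2,\dots$ are filled in as follows. At step $i=1,\dots,s$, take the first $k_i-k_{i-1}$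 vacant positions that are $\ge p_i$, and fill them, in increasing order, with the $k_i-k_{i-1}$ largest nonzero integers $\le -q_i$ whose absolute value has not been used in earlier steps. At the last step, fill the remaining vacant positions with the unused positive integers in increasing order. **Optional corners.** A corner $(k,p,q)\in\mathscr C(w)$ is *optional* for $\tau$ if $(p,q)\ne(p_i,q_i)$ for all $i$ and there are $a\le i\le s$ and $1\le j<a$ with $p=p_i$, $q_i<q=\bar q_j+1$ and $q_{i-1}\ge q$. The set of these is $\mathcal Op_\tau(w)$. **Proposition.** Let $\tau$ be a theta-triple and let $w\in\mathcal W_n$ be a signed permutation with $w=w(\tau)$. Then $\mathscr C(w)$ is the disjoint union $$\mathscr C(w)=\{(k_i,p_i,q_i):1\le i\le s\}\ \dot\cup\ \mathcal Op_\tau(w)\ \dot\cup\ \mathscr U(w).$$ -/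

import Mathlib

namespace ThetaVex

/-! ### Signed permutations, corners, the northeast path -/

/-- `w`, written in full form as a permutation of `ℤ`, is a signed permutation lying in `𝒲ₙ`:
`w(-i) = -w(i)` for all `i`, and `w(m) = m` for all `m > n`. -/
def IsSignedPerm (n : ℕ) (w : Equiv.Perm ℤ) : Prop :=
  (∀ i : ℤ, w (-i) = -w i) ∧ ∀ m : ℤ, (n : ℤ) < m → w m = m

/-- The box in row `a` and column `b` is a southeast corner of the diagram of `w`: `w` has a
descent at `b` with `a` in the interval of the jump, and `w⁻¹` has a descent at `a` with `b` in the
interval of the jump. -/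
def IsSECorner (w : Equiv.Perm ℤ) (a b : ℤ) : Prop :=
  (a < w b ∧ w (b + 1) ≤ a) ∧ (b < w.symm a ∧ w.symm (a + 1) ≤ b)

/-- `(p, q)` is a corner position of the signed permutation `w`: the box `(q - 1, -p)` is a
southeast corner, and it lies in a column of negative index (the extended diagram).
For `w ∈ 𝒲ₙ` the inequalities force `p ≤ n` and `-n ≤ q - 1 < n`; in the last column `p = 1`, since
`w(0) = 0`, they force `q > 0`, so that no position `(1, q)` with `q < 0` occurs. -/
def IsCornerPos (w : Equiv.Perm ℤ) (p q : ℤ) : Prop :=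
  1 ≤ p ∧ IsSECorner w (q - 1) (-p)

/-- The rank function `r_w(p, q) = #{i ≥ p | w(i) ≤ -q}`. -/
noncomputable def rank (w : Equiv.Perm ℤ) (p q : ℤ) : ℕ :=
  Set.ncard {i : ℤ | p ≤ i ∧ w i ≤ -q}

/-- The set of corners `𝒞(w)`: all triples `(k, p, q)` with `(p, q)` a corner position and
`k = r_w(p, q)`. -/
def cornerSet (w : Equiv.Perm ℤ) : Set (ℕ × ℤ × ℤ) :=
  {t | IsCornerPos w t.2.1 t.2.2 ∧ t.1 = rank w t.2.1 t.2.2}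

/-- The strict partial order on positions: `(p, q) < (p', q')` iff `p > p'` and `q < q'`. -/
def PosLT (x y : ℤ × ℤ) : Prop :=
  y.1 < x.1 ∧ x.2 < y.2

/-- The northeast path: the corner positions that are minimal for `PosLT` among the corner
positions of `w`. -/
def nePath (w : Equiv.Perm ℤ) : Set (ℤ × ℤ) :=
  {x | IsCornerPos w x.1 x.2 ∧ ∀ y : ℤ × ℤ, IsCornerPos w y.1 y.2 → ¬ PosLT y x}

/-- The set `𝒰(w)` of unessential corners. -/
def unessential (w : Equiv.Perm ℤ) : Set (ℕ × ℤ × ℤ) :=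
  {t | t ∈ cornerSet w ∧
    ∃ x₁ ∈ nePath w, ∃ x₂ ∈ nePath w, ∃ x₃ ∈ nePath w,
      (x₁.1 = t.2.1 ∧ x₁.2 < t.2.2 ∧ t.2.2 < 0) ∧
      (0 < x₂.1 ∧ x₂.2 = -t.2.2 + 1) ∧
      PosLT x₃ (t.2.1, t.2.2)}

/-! ### Theta-triples -/

/-- Three `s`-tuples `k`, `p`, `q` of integers, with entries indexed by `1, …, s`. Of the values at
other indices only `k 0` is ever used; it is `0` for a theta-triple. -/
structure TripleSeq where
  s : ℕ
  k : ℕ → ℕ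
  p : ℕ → ℤ
  q : ℕ → ℤ

/-- The index `a` with `q (a-1) > 0 > q a`; it is `1` if all `q i` are negative and `s + 1` if all
are positive. -/
def TripleSeq.a (τ : TripleSeq) : ℕ :=
  Nat.findGreatest (fun j => 0 < τ.q j) τ.s + 1

/-- For `a ≤ i ≤ s`, the index `R(i)` with `q (R(i)) > -q i > q (R(i)+1)`, where `q 0 = +∞`:
the greatest `j` with `1 ≤ j ≤ s` and `q j > -q i`, or `0` if there is none. -/
def TripleSeq.R (τ : TripleSeq) (i : ℕ) : ℕ :=
  Nat.findGreatest (fun j => -τ.q i < τ.q j) τ.s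

/-- `τ` is a theta-triple. -/
structure IsThetaTriple (τ : TripleSeq) : Prop where
  k_zero : τ.k 0 = 0
  k_lt : ∀ i, i < τ.s → τ.k i < τ.k (i + 1)
  p_anti : ∀ i, 1 ≤ i → i < τ.s → τ.p (i + 1) ≤ τ.p i
  p_pos : ∀ i, 1 ≤ i → i ≤ τ.s → 0 < τ.p i
  q_anti : ∀ i, 1 ≤ i → i < τ.s → τ.q (i + 1) ≤ τ.q i
  A1 : ∀ i, 1 ≤ i → i ≤ τ.s → τ.q i ≠ 0
  A2 : ∀ i j, 1 ≤ i → i ≤ τ.s → 1 ≤ j → j ≤ τ.s → i ≠ j → τ.q i ≠ -τ.q j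
  A3 : 1 ≤ τ.s → τ.q τ.s < 0 → 1 < τ.p τ.s
  B1 : ∀ i, 1 ≤ i → i + 1 < τ.a →
    (τ.p i - τ.p (i + 1)) + (τ.q i - τ.q (i + 1)) > (τ.k (i + 1) : ℤ) - τ.k i
  B2 : ∀ i, τ.a ≤ i → i < τ.s →
    (τ.p i - τ.p (i + 1)) + (τ.q i - τ.q (i + 1)) >
      ((τ.k (i + 1) : ℤ) - τ.k i) + ((τ.k (τ.R i) : ℤ) - τ.k (τ.R (i + 1)))
  B3 : τ.a ≤ τ.s → τ.p τ.s + τ.q τ.s + τ.k τ.s > (τ.k (τ.R τ.s) : ℤ) + 1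
  C1 : ∀ i, τ.a ≤ i → i ≤ τ.s → -τ.q i ≥ (τ.k i : ℤ) - τ.k (τ.R i)
  C2 : ∀ i j, τ.a ≤ i → i ≤ τ.s → τ.R i < j → j < τ.a →
    -τ.q i ≥ τ.q j + τ.k j - τ.k (τ.R i)

/-- The set of triples `(k i, p i, q i)`, `1 ≤ i ≤ s`. -/
def TripleSeq.toSet (τ : TripleSeq) : Set (ℕ × ℤ × ℤ) :=
  {t | ∃ i, 1 ≤ i ∧ i ≤ τ.s ∧ t = (τ.k i, τ.p i, τ.q i)}

/-! ### The permutation constructed from a triple -/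

/-- In the partial word `P`, a list of pairs (position, entry), the position `z` is available. -/
def PosFree (P : List (ℤ × ℤ)) (z : ℤ) : Prop :=
  ∀ e ∈ P, e.1 ≠ z

/-- The number `x` is nonzero and its absolute value is not used in the partial word `P`. -/
def ValFree (P : List (ℤ × ℤ)) (x : ℤ) : Prop :=
  x ≠ 0 ∧ ∀ e ∈ P, |e.2| ≠ |x|

/-- One step: the first `m` available positions from `p` on are filled, in increasing order, with
the `m` largest numbers `≤ -q` whose absolute value is unused. -/
noncomputable def step (P : List (ℤ × ℤ)) (m : ℕ) (p q : ℤ) : List (ℤ × ℤ) :=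
  P ++ (List.range m).map fun j =>
    (p + (Nat.nth (fun t : ℕ => PosFree P (p + t)) j : ℤ),
      -q - (Nat.nth (fun t : ℕ => ValFree P (-q - t)) (m - 1 - j) : ℤ))

/-- The partial word after the first `i` steps. -/
noncomputable def placed (τ : TripleSeq) : ℕ → List (ℤ × ℤ)
  | 0 => []
  | i + 1 => step (placed τ i) (τ.k (i + 1) - τ.k i) (τ.p (i + 1)) (τ.q (i + 1))

open Classical in
/-- The entry at the position `z ≥ 1` of `w(τ)`: the one placed by the first `s` steps, if there is
one; otherwise the last step fills the available positions with the unused positive numbers, in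
increasing order. -/
noncomputable def entry (τ : TripleSeq) (z : ℕ) : ℤ :=
  ((placed τ τ.s).lookup (z : ℤ)).getD
    (Nat.nth (fun x : ℕ => ValFree (placed τ τ.s) x)
      (Nat.count (fun y : ℕ => 1 ≤ y ∧ PosFree (placed τ τ.s) y) z) : ℤ)

/-- `w = w(τ)`, in one-line notation. -/
def IsPermOf (τ : TripleSeq) (w : Equiv.Perm ℤ) : Prop :=
  ∀ z : ℕ, 1 ≤ z → w z = entry τ z

/-- The set of optional corners of `w` with respect to `τ`. -/
def optional (τ : TripleSeq) (w : Equiv.Perm ℤ) : Set (ℕ × ℤ × ℤ) :=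
  {t | t ∈ cornerSet w ∧
    (∀ i, 1 ≤ i → i ≤ τ.s → (t.2.1, t.2.2) ≠ (τ.p i, τ.q i)) ∧
    ∃ i j, (τ.a ≤ i ∧ i ≤ τ.s) ∧ (1 ≤ j ∧ j < τ.a) ∧
      t.2.1 = τ.p i ∧ τ.q i < t.2.2 ∧ t.2.2 = -τ.q j + 1 ∧ t.2.2 ≤ τ.q (i - 1)}

end ThetaVex

/-! Label each positive position `x` by the step `st x` that fills it. C1 and C2 fix signs and
sizes: entries of steps before `a` are negative, all others positive, and for `i ≥ a` the entries of
steps up to `R i` exceed `-q i` in absolute value, while those of the remaining steps before `a`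
stay below it (`pos_of_a_le`, `neg_lt_of_R_lt`). With these, B1–B3 give the key fact
`Staging.avoid`: an entry placed after step `i` is never in the quadrant `x ≥ p i - 1`, `w x ≤ -q i
+ 1`, except at its vertex, because a step reaching into it would have to fill too many positions
and values. So the quadrant `x ≥ p i`, `w x ≤ -q i` holds exactly the first `k i` entries, `(p i, q
i)` is a corner of rank `k i`, and every inversion has its larger entry placed at a later step.
Conversely, at a corner `(p, q)` the later of the steps that fill `p` and place `-q` has `p i = p`.
There `q = q i`, unless `-q + 1` was skipped because `q - 1` had been placed, which forces `q l = -q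
+ 1` for some `l < a`. Comparing `q` with `q (i - 1)` for the least suitable `i` then separates
optional from unessential corners. -/

namespace ThetaVex

/-! ### Consequences of the definition of a theta-triple -/

namespace IsThetaTriple

variable {τ : TripleSeq}

theorem q_le (hτ : IsThetaTriple τ) {i j : ℕ} (hi : 1 ≤ i) (hij : i ≤ j) (hj : j ≤ τ.s) :
    τ.q j ≤ τ.q i := by
  induction j, hij using Nat.le_induction with
  | base => exact le_rfl
  | succ j hij ih => exact (hτ.q_anti j (by omega) (by omega)).trans (ih (by omega))

theorem p_le (hτ : IsThetaTriple τ) {i j : ℕ} (hi : 1 ≤ i) (hij : i ≤ j) (hj : j ≤ τ.s) :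
    τ.p j ≤ τ.p i := by
  induction j, hij using Nat.le_induction with
  | base => exact le_rfl
  | succ j hij ih => exact (hτ.p_anti j (by omega) (by omega)).trans (ih (by omega))

theorem k_le (hτ : IsThetaTriple τ) {i j : ℕ} (hij : i ≤ j) (hj : j ≤ τ.s) :
    τ.k i ≤ τ.k j := by
  induction j, hij using Nat.le_induction with
  | base => exact le_rfl
  | succ j hij ih => exact (ih (by omega)).trans (hτ.k_lt j (by omega)).le

theorem k_lt_k (hτ : IsThetaTriple τ) {i j : ℕ} (hij : i < j) (hj : j ≤ τ.s) :
    τ.k i < τ.k j :=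
  (hτ.k_lt i (by omega)).trans_le (hτ.k_le hij hj)

theorem q_pos (hτ : IsThetaTriple τ) {i : ℕ} (hi : 1 ≤ i) (hia : i < τ.a) : 0 < τ.q i := by
  have hg : i ≤ Nat.findGreatest (fun j => 0 < τ.q j) τ.s := by
    unfold TripleSeq.a at hia; omega
  have h := Nat.findGreatest_of_ne_zero (P := fun j => 0 < τ.q j) (n := τ.s) rfl (by omega)
  exact lt_of_lt_of_le h (hτ.q_le hi hg (Nat.findGreatest_le _))

theorem q_neg (hτ : IsThetaTriple τ) {i : ℕ} (hia : τ.a ≤ i) (hi : i ≤ τ.s) : τ.q i < 0 := by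
  have hia' : Nat.findGreatest (fun j => 0 < τ.q j) τ.s < i := by
    unfold TripleSeq.a at hia; omega
  have h := Nat.findGreatest_is_greatest hia' hi
  have := hτ.A1 i (by omega) hi
  omega

theorem a_le_of_q_neg (hτ : IsThetaTriple τ) {i : ℕ} (hi : 1 ≤ i) (hq : τ.q i < 0) :
    τ.a ≤ i := by
  by_contra h
  have := hτ.q_pos hi (by omega)
  omega

theorem one_le_a (τ : TripleSeq) : 1 ≤ τ.a := by
  unfold TripleSeq.a; omega

theorem lt_q_of_le_R (hτ : IsThetaTriple τ) {i j : ℕ} (hj : 1 ≤ j) (hjR : j ≤ τ.R i) :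
    -τ.q i < τ.q j := by
  have h := Nat.findGreatest_of_ne_zero (P := fun j => -τ.q i < τ.q j) (n := τ.s)
    (m := τ.R i) rfl (by omega)
  exact lt_of_lt_of_le h (hτ.q_le hj hjR (Nat.findGreatest_le _))

theorem le_R_of_lt_q {i j : ℕ} (hj : j ≤ τ.s) (hq : -τ.q i < τ.q j) : j ≤ τ.R i :=
  Nat.le_findGreatest hj hq

theorem R_lt_a (hτ : IsThetaTriple τ) {i : ℕ} (hia : τ.a ≤ i) (hi : i ≤ τ.s) : τ.R i < τ.a := by
  by_contra h
  have h1 := hτ.lt_q_of_le_R (i := i) (j := τ.R i) (by have := one_le_a τ; omega) le_rfl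
  have h2 := hτ.q_neg hia hi
  have h3 := hτ.q_neg (i := τ.R i) (by omega) (Nat.findGreatest_le _)
  omega

end IsThetaTriple

/-! ### Signed permutations and corner positions -/

theorem IsSignedPerm.map_zero {n : ℕ} {w : Equiv.Perm ℤ} (hw : IsSignedPerm n w) : w 0 = 0 := by
  have := hw.1 0
  simp only [neg_zero] at this
  omega

theorem IsSignedPerm.symm_neg {n : ℕ} {w : Equiv.Perm ℤ} (hw : IsSignedPerm n w) (u : ℤ) :
    w.symm (-u) = -w.symm u := by
  rw [Equiv.symm_apply_eq, hw.1, Equiv.apply_symm_apply]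

/-- Oddness of `w` and `w.symm` reflects the box through the origin, so only the positions `p - 1`,
`p` and the values `-q`, `-q + 1` matter. -/
theorem isCornerPos_iff {n : ℕ} {w : Equiv.Perm ℤ} (hw : IsSignedPerm n w) (p q : ℤ) :
    IsCornerPos w p q ↔
      1 ≤ p ∧ w p ≤ -q ∧ -q < w (p - 1) ∧ w.symm (-q + 1) < p ∧ p ≤ w.symm (-q) := by
  have h1 : w (-p) = -w p := hw.1 p
  have h2 : w (-p + 1) = -w (p - 1) := by rw [← hw.1]; congr 1; ring
  have h3 : w.symm (q - 1) = -w.symm (-q + 1) := by rw [← hw.symm_neg]; congr 1; ring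
  have h4 : w.symm (q - 1 + 1) = -w.symm (-q) := by rw [← hw.symm_neg]; congr 1; ring
  unfold IsCornerPos IsSECorner
  rw [h1, h2, h3, h4]
  constructor <;> rintro ⟨h, h'⟩ <;> refine ⟨h, ?_⟩
  · obtain ⟨⟨_, _⟩, _, _⟩ := h'
    refine ⟨?_, ?_, ?_, ?_⟩ <;> omega
  · obtain ⟨_, _, _, _⟩ := h'
    refine ⟨⟨?_, ?_⟩, ?_, ?_⟩ <;> omega

/-! ### The steps of the construction -/

/-- The positive positions of `w` are filled in steps `1, …, s + 1` according to `τ`; `st x` is the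
step at which the position `x` is filled, and `S i` is the set of positions filled by the first `i`
steps. -/
structure Staging (τ : TripleSeq) (w : Equiv.Perm ℤ) (st : ℤ → ℕ) (S : ℕ → Finset ℤ) : Prop where
  one_le : ∀ x, 1 ≤ x → 1 ≤ st x
  le : ∀ x, 1 ≤ x → st x ≤ τ.s + 1
  mem : ∀ i, i ≤ τ.s → ∀ x, x ∈ S i ↔ 1 ≤ x ∧ st x ≤ i
  card : ∀ i, i ≤ τ.s → (S i).card = τ.k i
  pos_le : ∀ x, 1 ≤ x → st x ≤ τ.s → τ.p (st x) ≤ x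
  val_le : ∀ x, 1 ≤ x → st x ≤ τ.s → w x ≤ -τ.q (st x)
  mono : ∀ x y, 1 ≤ x → x < y → st x = st y → w x < w y
  pos_fill : ∀ x y, 1 ≤ y → y < x → st x ≤ τ.s → τ.p (st x) ≤ y → st y ≤ st x
  val_fill : ∀ x u, 1 ≤ x → st x ≤ τ.s → w x < u → u ≤ -τ.q (st x) → u ≠ 0 →
    ∃ y, 1 ≤ y ∧ ((st y = st x ∧ w y = u) ∨ (st y < st x ∧ |w y| = |u|))
  last_pos : ∀ x, 1 ≤ x → st x = τ.s + 1 → 0 < w x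

namespace Staging

variable {n : ℕ} {τ : TripleSeq} {w : Equiv.Perm ℤ} {st : ℤ → ℕ} {S : ℕ → Finset ℤ}

theorem val_le_of_le (H : Staging τ w st S) (hτ : IsThetaTriple τ) {x : ℤ} {i : ℕ} (hx : 1 ≤ x)
    (hi : i ≤ τ.s) (h : st x ≤ i) : w x ≤ -τ.q i := by
  have := H.val_le x hx (by omega)
  have := hτ.q_le (H.one_le x hx) h hi
  omega

theorem pos_le_of_le (H : Staging τ w st S) (hτ : IsThetaTriple τ) {x : ℤ} {i : ℕ} (hx : 1 ≤ x)
    (hi : i ≤ τ.s) (h : st x ≤ i) : τ.p i ≤ x := by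
  have := H.pos_le x hx (by omega)
  have := hτ.p_le (H.one_le x hx) h hi
  omega

theorem val_fill_le (H : Staging τ w st S) {x u : ℤ} (hx : 1 ≤ x) (hs : st x ≤ τ.s)
    (h1 : w x < u) (h2 : u ≤ -τ.q (st x)) (h3 : u ≠ 0) :
    ∃ y, 1 ≤ y ∧ st y ≤ st x ∧ y ≠ x ∧ |w y| = |u| := by
  obtain ⟨y, hy, ⟨h4, h5⟩ | ⟨h4, h5⟩⟩ := H.val_fill x u hx hs h1 h2 h3
  · exact ⟨y, hy, h4.le, by rintro rfl; omega, by rw [h5]⟩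
  · exact ⟨y, hy, h4.le, by rintro rfl; omega, h5⟩

/-! ### Signs and sizes of the entries -/

theorem neg_of_lt_a (H : Staging τ w st S) (hτ : IsThetaTriple τ) {x : ℤ} (hx : 1 ≤ x)
    (hs : st x ≤ τ.s) (h : st x < τ.a) : w x < 0 := by
  have := H.val_le x hx hs
  have := hτ.q_pos (H.one_le x hx) h
  omega

theorem lt_neg_of_le_R (H : Staging τ w st S) (hτ : IsThetaTriple τ) {x : ℤ} {i : ℕ} (hx : 1 ≤ x)
    (h : st x ≤ τ.R i) : -τ.q i < -w x := by
  have := H.val_le x hx (h.trans (Nat.findGreatest_le _))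
  have := hτ.lt_q_of_le_R (H.one_le x hx) h
  omega

theorem card_sdiff (H : Staging τ w st S) {i j : ℕ} (hij : i ≤ j) (hj : j ≤ τ.s) :
    ((S j \ S i).card : ℤ) = τ.k j - τ.k i := by
  have hsub : S i ⊆ S j := fun x hx => by
    rw [H.mem i (hij.trans hj)] at hx
    rw [H.mem j hj]
    exact ⟨hx.1, hx.2.trans hij⟩
  have h1 := Finset.card_sdiff_add_card_eq_card hsub
  rw [H.card j hj, H.card i (hij.trans hj)] at h1
  omega

theorem mem_sdiff (H : Staging τ w st S) {i j : ℕ} (hij : i ≤ j) (hj : j ≤ τ.s) (x : ℤ) :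
    x ∈ S j \ S i ↔ 1 ≤ x ∧ i < st x ∧ st x ≤ j := by
  rw [Finset.mem_sdiff, H.mem j hj, H.mem i (hij.trans hj)]
  constructor
  · rintro ⟨⟨h1, h2⟩, h3⟩
    exact ⟨h1, by by_contra h; exact h3 ⟨h1, by omega⟩, h2⟩
  · rintro ⟨h1, h2, h3⟩
    exact ⟨⟨h1, h3⟩, fun h => by omega⟩

/-- A count against C1. If `w x ≤ 0` and `i = st x ≤ s`, each of `1, …, -q i` is eligible and larger
than `w x`, so its absolute value is used at a position other than `x` by step `i`, but not by step
`R i`. Only `k i - k (R i) - 1` positions remain for these `-q i` values. -/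
theorem pos_of_a_le (H : Staging τ w st S) (hτ : IsThetaTriple τ) {x : ℤ} (hx : 1 ≤ x)
    (h : τ.a ≤ st x) : 0 < w x := by
  rcases (H.le x hx).lt_or_eq with hs | hs
  swap
  · exact H.last_pos x hx hs
  have hs : st x ≤ τ.s := by omega
  by_contra hneg
  have hR := hτ.R_lt_a h hs
  have hsub : Finset.Icc 1 (-τ.q (st x)) ⊆
      ((S (st x) \ S (τ.R (st x))).erase x).image (fun y => |w y|) := by
    intro u hu
    rw [Finset.mem_Icc] at hu
    obtain ⟨y, hy, h1, h2, h3⟩ := H.val_fill_le hx hs (u := u) (by omega) hu.2 (by omega)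
    rw [abs_of_pos (a := u) (by omega)] at h3
    refine Finset.mem_image.2 ⟨y, Finset.mem_erase.2 ⟨h2, ?_⟩, h3⟩
    refine (H.mem_sdiff (by omega) hs y).2 ⟨hy, ?_, h1⟩
    by_contra h4
    have h5 := H.lt_neg_of_le_R hτ (i := st x) hy (by omega)
    have := neg_le_abs (w y)
    omega
  have hcard := (Finset.card_le_card hsub).trans Finset.card_image_le
  rw [Finset.card_erase_of_mem ((H.mem_sdiff (by omega) hs x).2 ⟨hx, by omega, le_rfl⟩),
    Int.card_Icc] at hcard
  have h1 := H.card_sdiff (i := τ.R (st x)) (j := st x) (by omega) hs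
  have h2 := hτ.C1 _ h hs
  have h3 := hτ.k_lt_k (i := τ.R (st x)) (j := st x) (by omega) hs
  omega

/-- The same count with a window of `k j - k (R i)` absolute values starting at `q j`, where `j = st
x`. C2 puts the whole window below `-q i`, so if `-w x ≥ -q i`, all of it is used by positions other
than `x` in steps `R i + 1, …, j`. -/
theorem neg_lt_of_R_lt (H : Staging τ w st S) (hτ : IsThetaTriple τ) {x : ℤ} {i : ℕ} (hx : 1 ≤ x)
    (hia : τ.a ≤ i) (hi : i ≤ τ.s) (h1 : τ.R i < st x) (h2 : st x < τ.a) : -w x < -τ.q i := by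
  have hs : st x ≤ τ.s := by omega
  by_contra hge
  have hC := hτ.C2 i (st x) hia hi h1 h2
  have hqp := hτ.q_pos (H.one_le x hx) h2
  have hsub : Finset.Ico (τ.q (st x)) (τ.q (st x) + τ.k (st x) - τ.k (τ.R i)) ⊆
      ((S (st x) \ S (τ.R i)).erase x).image (fun y => |w y|) := by
    intro u hu
    rw [Finset.mem_Ico] at hu
    obtain ⟨y, hy, h3, h4, h5⟩ := H.val_fill_le hx hs (u := -u) (by omega) (by omega) (by omega)
    rw [abs_neg, abs_of_pos (a := u) (by omega)] at h5
    refine Finset.mem_image.2 ⟨y, Finset.mem_erase.2 ⟨h4, ?_⟩, h5⟩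
    refine (H.mem_sdiff h1.le hs y).2 ⟨hy, ?_, h3⟩
    by_contra h6
    have h7 := H.lt_neg_of_le_R hτ (i := i) hy (by omega)
    have := neg_le_abs (w y)
    omega
  have hcard := (Finset.card_le_card hsub).trans Finset.card_image_le
  rw [Finset.card_erase_of_mem ((H.mem_sdiff h1.le hs x).2 ⟨hx, h1, le_rfl⟩),
    Int.card_Ico] at hcard
  have h3 := H.card_sdiff h1.le hs
  have h4 := hτ.k_lt_k h1 hs
  omega

/-! ### The quadrant that later entries avoid -/

/-- To reach `x`, step `i + 1` must fill every position from `p (i + 1)` to `p i - 1`; to get down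
to `w x`, it must place every value of `U`. These requirements use different positions. -/
theorem card_add_le (H : Staging τ w st S) (hτ : IsThetaTriple τ) {x : ℤ} {i : ℕ} (hi : 1 ≤ i)
    (his : i + 1 ≤ τ.s) (hx : 1 ≤ x) (hst : st x = i + 1) (hp : τ.p i - 1 ≤ x)
    (hv : w x ≤ -τ.q i + 1) (hne : ¬(x = τ.p i - 1 ∧ w x = -τ.q i + 1)) (U : Finset ℤ)
    (hU : ∀ u ∈ U, -τ.q i < u ∧ u ≤ -τ.q (i + 1) ∧ u ≠ 0 ∧
      ∀ y, 1 ≤ y → st y ≤ i → |w y| ≠ |u|) :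
    (U.card : ℤ) + (τ.p i - τ.p (i + 1)) ≤ (τ.k (i + 1) : ℤ) - τ.k i := by
  have hp1 := hτ.p_pos (i + 1) (by omega) his
  have hA : ∀ y ∈ Finset.Ico (τ.p (i + 1)) (τ.p i), 1 ≤ y ∧ st y = i + 1 ∧ w y ≤ w x ∧
      (y = x ∨ w y < w x) := by
    intro y hy
    rw [Finset.mem_Ico] at hy
    have hst' : st y = i + 1 := by
      have h1 : i < st y := by
        by_contra h
        have := H.pos_le_of_le hτ (x := y) (i := i) (by omega) (by omega) (by omega)
        omega
      rcases eq_or_ne y x with rfl | hyx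
      · exact hst
      · have := H.pos_fill x y (by omega) (by omega) (by omega) (by rw [hst]; omega)
        omega
    rcases eq_or_ne y x with rfl | hyx
    · exact ⟨by omega, hst', le_rfl, Or.inl rfl⟩
    · have := H.mono y x (by omega) (by omega) (by omega)
      exact ⟨by omega, hst', this.le, Or.inr this⟩
  have hB : ∀ u ∈ U, 1 ≤ w.symm u ∧ st (w.symm u) = i + 1 := by
    intro u hu
    obtain ⟨h1, h2, h3, h4⟩ := hU u hu
    rcases eq_or_ne (w x) u with h | h
    · rw [← h, Equiv.symm_apply_apply]
      exact ⟨hx, hst⟩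
    · obtain ⟨y, hy, ⟨h5, h6⟩ | ⟨h5, h6⟩⟩ :=
        H.val_fill x u hx (by omega) (by omega) (by rw [hst]; exact h2) h3
      · rw [← h6, Equiv.symm_apply_apply]
        exact ⟨hy, by omega⟩
      · exact absurd h6 (h4 y hy (by omega))
  -- A position below `p i` with entry in `U` could only be `x = p i - 1` with `w x = -q i + 1`,
  -- which `hne` excludes.
  have hdisj : Disjoint (Finset.Ico (τ.p (i + 1)) (τ.p i)) (U.image w.symm) := by
    rw [Finset.disjoint_left]
    intro y hy hy'
    obtain ⟨u, hu, rfl⟩ := Finset.mem_image.1 hy'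
    obtain ⟨h1, h2, h3, h4⟩ := hA _ hy
    rw [Equiv.apply_symm_apply] at h3 h4
    obtain ⟨h5, -⟩ := hU u hu
    rw [Finset.mem_Ico] at hy
    rcases h4 with h4 | h4
    · have : w x = u := by rw [← h4, Equiv.apply_symm_apply]
      omega
    · omega
  have hsub : Finset.Ico (τ.p (i + 1)) (τ.p i) ∪ U.image w.symm ⊆ S (i + 1) \ S i := by
    intro y hy
    rw [H.mem_sdiff (by omega) his]
    rcases Finset.mem_union.1 hy with hy | hy
    · obtain ⟨h1, h2, -⟩ := hA y hy
      exact ⟨h1, by omega, by omega⟩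
    · obtain ⟨u, hu, rfl⟩ := Finset.mem_image.1 hy
      obtain ⟨h1, h2⟩ := hB u hu
      exact ⟨h1, by omega, by omega⟩
  have hcard := Finset.card_le_card hsub
  rw [Finset.card_union_of_disjoint hdisj, Finset.card_image_of_injective _ w.symm.injective,
    Int.card_Ico] at hcard
  have h1 := H.card_sdiff (i := i) (j := i + 1) (by omega) his
  have h2 := hτ.p_anti i hi (by omega)
  omega

/-- No position `x` filled at step `i + 1` satisfies `x ≥ p i - 1` and `w x ≤ -q i + 1`, unless both
are equalities. -/
theorem avoid_succ (H : Staging τ w st S) (hw : IsSignedPerm n w) (hτ : IsThetaTriple τ) {x : ℤ}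
    {i : ℕ} (hi : 1 ≤ i) (his : i ≤ τ.s) (hx : 1 ≤ x) (hst : st x = i + 1)
    (hp : τ.p i - 1 ≤ x) (hv : w x ≤ -τ.q i + 1) :
    x = τ.p i - 1 ∧ w x = -τ.q i + 1 := by
  by_contra hne
  rcases lt_or_ge i τ.a with hia | hia
  · have hq := hτ.q_pos hi hia
    rcases lt_or_ge (i + 1) τ.a with hia' | hia'
    · have his' : i + 1 ≤ τ.s := by
        have := Nat.findGreatest_le (P := fun j => 0 < τ.q j) τ.s
        unfold TripleSeq.a at hia'
        omega
      have hq' := hτ.q_pos (i := i + 1) (by omega) hia'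
      have h1 := H.card_add_le hτ hi his' hx hst hp hv hne (Finset.Ioc (-τ.q i) (-τ.q (i + 1)))
        (fun u hu => by
          rw [Finset.mem_Ioc] at hu
          refine ⟨hu.1, hu.2, by omega, fun y hy hyi habs => ?_⟩
          have := H.val_le_of_le hτ hy his hyi
          rw [abs_of_neg (by omega), abs_of_neg (by omega)] at habs
          omega)
      rw [Int.card_Ioc] at h1
      have h2 := hτ.B1 i hi hia'
      omega
    -- The entry is positive, whereas `-q i + 1 ≤ 0`.
    · have := H.pos_of_a_le hτ hx (by omega)
      omega
  rcases his.lt_or_eq with his' | rfl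
  · have hR := hτ.R_lt_a hia his
    have hRR : τ.R (i + 1) ≤ τ.R i := by
      rcases Nat.eq_zero_or_pos (τ.R (i + 1)) with h | h
      · omega
      · refine IsThetaTriple.le_R_of_lt_q (Nat.findGreatest_le _) ?_
        have := hτ.lt_q_of_le_R h le_rfl
        have := hτ.q_anti i hi his'
        omega
    have hqi := hτ.q_neg hia his
    have h1 := H.card_add_le hτ hi his' hx hst hp hv hne
      -- Absolute values in this interval already used come only from steps `R (i + 1) + 1, …, R i`:
      -- earlier ones are too large, later ones too small. Removing them costs at most the `R`-term
      -- of B2.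
      (Finset.Ioc (-τ.q i) (-τ.q (i + 1)) \ (S (τ.R i) \ S (τ.R (i + 1))).image (fun y => -w y))
      (fun u hu => by
        rw [Finset.mem_sdiff, Finset.mem_Ioc, Finset.mem_image] at hu
        obtain ⟨⟨hu1, hu2⟩, hu3⟩ := hu
        refine ⟨hu1, hu2, by omega, fun y hy hyi habs => ?_⟩
        rw [abs_of_pos (a := u) (by omega)] at habs
        rcases lt_or_ge (st y) τ.a with hya | hya
        · have hneg := H.neg_of_lt_a hτ hy (by omega) hya
          rw [abs_of_neg hneg] at habs
          refine hu3 ⟨y, (H.mem_sdiff hRR (by omega) y).2 ⟨hy, ?_, ?_⟩, habs⟩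
          · by_contra h
            have := H.lt_neg_of_le_R hτ (i := i + 1) hy (by omega)
            omega
          · by_contra h
            have := H.neg_lt_of_R_lt hτ hy hia his (by omega) hya
            omega
        · have hpos := H.pos_of_a_le hτ hy hya
          rw [abs_of_pos hpos] at habs
          have := H.val_le_of_le hτ hy his hyi
          omega)
    have h2 := Finset.le_card_sdiff ((S (τ.R i) \ S (τ.R (i + 1))).image (fun y => -w y))
      (Finset.Ioc (-τ.q i) (-τ.q (i + 1)))
    have h3 : ((S (τ.R i) \ S (τ.R (i + 1))).image (fun y => -w y)).card ≤ _ :=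
      Finset.card_image_le
    have h4 := H.card_sdiff hRR (by omega)
    rw [Int.card_Ioc] at h2
    have h5 := hτ.B2 i hia his'
    omega
  -- The last step has no prescribed size. Instead, the `p s - 1` entries before `p s` and the
  -- entries of steps `R s + 1, …, s` have distinct absolute values in `[1, -q s]`, against B3.
  · have hR := hτ.R_lt_a hia le_rfl
    have hqs := hτ.q_neg hia le_rfl
    have hps := hτ.A3 hi hqs
    have hA : ∀ y ∈ Finset.Ico 1 (τ.p τ.s), τ.s < st y ∧ 1 ≤ w y ∧ w y ≤ -τ.q τ.s := by
      intro y hy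
      rw [Finset.mem_Ico] at hy
      have h1 : τ.s < st y := by
        by_contra h
        have := H.pos_le_of_le hτ (x := y) hy.1 le_rfl (by omega)
        omega
      have h2 : st y = τ.s + 1 := by have := H.le y hy.1; omega
      refine ⟨h1, H.last_pos y hy.1 h2, ?_⟩
      rcases eq_or_ne y x with rfl | hyx
      · omega
      · have := H.mono y x hy.1 (by omega) (by omega)
        omega
    have hB : ∀ y ∈ S τ.s \ S (τ.R τ.s), 1 ≤ y ∧ st y ≤ τ.s ∧ 1 ≤ |w y| ∧ |w y| ≤ -τ.q τ.s := by
      intro y hy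
      obtain ⟨h1, h2, h3⟩ := (H.mem_sdiff (by omega) le_rfl y).1 hy
      refine ⟨h1, h3, ?_⟩
      rcases lt_or_ge (st y) τ.a with hya | hya
      · have hneg := H.neg_of_lt_a hτ h1 h3 hya
        have := H.neg_lt_of_R_lt hτ h1 hia le_rfl h2 hya
        rw [abs_of_neg hneg]
        omega
      · have hpos := H.pos_of_a_le hτ h1 hya
        rw [abs_of_pos hpos]
        have := H.val_le_of_le hτ h1 le_rfl h3
        omega
    have habs : ∀ x y, 1 ≤ x → 1 ≤ y → |w x| = |w y| → x = y := by
      intro x y hx hy h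
      rcases abs_eq_abs.1 h with h | h
      · exact w.injective h
      · rw [← hw.1] at h
        have := w.injective h
        omega
    have hdisj : Disjoint (Finset.Ico 1 (τ.p τ.s)) (S τ.s \ S (τ.R τ.s)) := by
      rw [Finset.disjoint_left]
      intro y hy hy'
      have := hA y hy
      have := hB y hy'
      omega
    have hcard := Finset.card_le_card_of_injOn (s := Finset.Ico 1 (τ.p τ.s) ∪ (S τ.s \ S (τ.R τ.s)))
      (t := Finset.Icc 1 (-τ.q τ.s)) (fun y => |w y|)
      (fun y hy => by
        rw [Finset.mem_coe, Finset.mem_union] at hy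
        rw [Finset.mem_coe, Finset.mem_Icc]
        rcases hy with hy | hy
        · obtain ⟨-, h1, h2⟩ := hA y hy
          have h3 := abs_of_pos (show 0 < w y by omega)
          exact ⟨h1.trans_eq h3.symm, h3.trans_le h2⟩
        · exact (hB y hy).2.2)
      (fun y hy z hz hyz => by
        have hone : ∀ y ∈ Finset.Ico 1 (τ.p τ.s) ∪ (S τ.s \ S (τ.R τ.s)), 1 ≤ y := by
          intro y hy
          rcases Finset.mem_union.1 hy with hy | hy
          · exact (Finset.mem_Ico.1 hy).1
          · exact (hB y hy).1
        exact habs y z (hone y hy) (hone z hz) hyz)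
    rw [Finset.card_union_of_disjoint hdisj, Int.card_Ico, Int.card_Icc] at hcard
    have h1 := H.card_sdiff (i := τ.R τ.s) (j := τ.s) (by omega) le_rfl
    have h2 := hτ.B3 hia
    omega

/-- Since `p` and `q` decrease weakly, the quadrant of step `i` lies in that of step `st x - 1`; a
point of the former that is the vertex of the latter is the vertex of both. -/
theorem avoid (H : Staging τ w st S) (hw : IsSignedPerm n w) (hτ : IsThetaTriple τ) {x : ℤ}
    {i : ℕ} (hi : 1 ≤ i) (hx : 1 ≤ x) (hst : i < st x)
    (hp : τ.p i - 1 ≤ x) (hv : w x ≤ -τ.q i + 1) :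
    x = τ.p i - 1 ∧ w x = -τ.q i + 1 := by
  have hle := H.le x hx
  have h1 := hτ.p_le hi (j := st x - 1) (by omega) (by omega)
  have h2 := hτ.q_le hi (j := st x - 1) (by omega) (by omega)
  have h3 := H.avoid_succ hw hτ (i := st x - 1) (by omega) (by omega) hx (by omega) (by omega)
    (by omega)
  omega

/-! ### The members of the triple are corners -/

theorem exists_stage (H : Staging τ w st S) (hτ : IsThetaTriple τ) {i : ℕ} (hi : 1 ≤ i)
    (his : i ≤ τ.s) : ∃ x, 1 ≤ x ∧ st x = i := by
  have h1 := H.card_sdiff (i := i - 1) (j := i) (by omega) his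
  have h2 := hτ.k_lt_k (i := i - 1) (j := i) (by omega) his
  obtain ⟨x, hx⟩ := Finset.card_pos.1 (show 0 < (S i \ S (i - 1)).card by omega)
  obtain ⟨h3, h4, h5⟩ := (H.mem_sdiff (by omega) his x).1 hx
  exact ⟨x, h3, by omega⟩

theorem stage_p_le (H : Staging τ w st S) (hτ : IsThetaTriple τ) {i : ℕ} (hi : 1 ≤ i)
    (his : i ≤ τ.s) : st (τ.p i) ≤ i := by
  obtain ⟨x, hx, rfl⟩ := H.exists_stage hτ hi his
  rcases (H.pos_le x hx his).lt_or_eq with h | h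
  · exact H.pos_fill x _ (hτ.p_pos _ hi his) h his le_rfl
  · rw [h]

/-- The top value `-q i` is placed by step `i` unless its absolute value is used with the opposite
sign, which the sign and size bounds rule out. -/
theorem stage_symm_le (H : Staging τ w st S) (hτ : IsThetaTriple τ) {i : ℕ} (hi : 1 ≤ i)
    (his : i ≤ τ.s) : 1 ≤ w.symm (-τ.q i) ∧ st (w.symm (-τ.q i)) ≤ i := by
  suffices h : ∃ y, 1 ≤ y ∧ st y ≤ i ∧ w y = -τ.q i by
    obtain ⟨y, h1, h2, h3⟩ := h
    rw [← h3, Equiv.symm_apply_apply]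
    exact ⟨h1, h2⟩
  obtain ⟨x, hx, rfl⟩ := H.exists_stage hτ hi his
  rcases (H.val_le x hx his).lt_or_eq with h | h
  swap
  · exact ⟨x, hx, le_rfl, h⟩
  obtain ⟨y, hy, h1, -, h2⟩ := H.val_fill_le hx his h le_rfl
    (by have := hτ.A1 _ hi his; omega)
  refine ⟨y, hy, h1, ?_⟩
  rcases abs_eq_abs.1 h2 with h2 | h2
  · exact h2
  exfalso
  rcases lt_or_ge (st x) τ.a with hia | hia
  · have := hτ.q_pos hi hia
    have := H.neg_of_lt_a hτ hy (by omega) (by omega)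
    omega
  · have := hτ.q_neg hia his
    have hya : st y < τ.a := by
      by_contra h
      have := H.pos_of_a_le hτ hy (by omega)
      omega
    rcases le_or_gt (st y) (τ.R (st x)) with h3 | h3
    · have := H.lt_neg_of_le_R hτ hy h3
      omega
    · have := H.neg_lt_of_R_lt hτ hy hia his h3 hya
      omega

theorem isCornerPos (H : Staging τ w st S) (hw : IsSignedPerm n w) (hτ : IsThetaTriple τ) {i : ℕ}
    (hi : 1 ≤ i) (his : i ≤ τ.s) : IsCornerPos w (τ.p i) (τ.q i) := by
  have hp := hτ.p_pos i hi his
  rw [isCornerPos_iff hw]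
  refine ⟨hp, H.val_le_of_le hτ hp his (H.stage_p_le hτ hi his), ?_, ?_, ?_⟩
  · rcases eq_or_lt_of_le (show 1 ≤ τ.p i from hp) with h | h
    -- For `p i = 1` the preceding entry is `w 0 = 0`, so `q i > 0` is needed; this is what A3
    -- gives.
    · rw [← h, sub_self, hw.map_zero]
      by_contra hq
      have h1 := hτ.A1 i hi his
      have h2 := hτ.q_le hi his le_rfl
      have h3 := hτ.A3 (by omega) (by omega)
      have h4 := hτ.p_le hi his le_rfl
      omega
    · by_contra hlt
      have h1 : i < st (τ.p i - 1) := by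
        by_contra h2
        have := H.pos_le_of_le hτ (x := τ.p i - 1) (i := i) (by omega) his (by omega)
        omega
      have := H.avoid hw hτ hi (by omega) h1 le_rfl (by omega)
      omega
  · by_contra hlt
    have hx : w (w.symm (-τ.q i + 1)) = -τ.q i + 1 := w.apply_symm_apply _
    have h1 : i < st (w.symm (-τ.q i + 1)) := by
      by_contra h2
      have := H.val_le_of_le hτ (x := w.symm (-τ.q i + 1)) (i := i) (by omega) his (by omega)
      omega
    have := H.avoid hw hτ hi (by omega) h1 (by omega) (by omega)
    omega
  · obtain ⟨h1, h2⟩ := H.stage_symm_le hτ hi his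
    exact H.pos_le_of_le hτ h1 his h2

theorem rank_eq (H : Staging τ w st S) (hw : IsSignedPerm n w) (hτ : IsThetaTriple τ) {i : ℕ}
    (hi : 1 ≤ i) (his : i ≤ τ.s) : rank w (τ.p i) (τ.q i) = τ.k i := by
  have hp := hτ.p_pos i hi his
  have : {x : ℤ | τ.p i ≤ x ∧ w x ≤ -τ.q i} = (S i : Set ℤ) := by
    ext x
    rw [Finset.mem_coe, H.mem i his]
    constructor
    · rintro ⟨h1, h2⟩
      refine ⟨by omega, ?_⟩
      by_contra h3
      have := H.avoid hw hτ hi (x := x) (by omega) (by omega) (by omega) (by omega)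
      omega
    · rintro ⟨h1, h2⟩
      exact ⟨H.pos_le_of_le hτ h1 his h2, H.val_le_of_le hτ h1 his h2⟩
  rw [rank, this, Set.ncard_coe_finset, H.card i his]

/-! ### Determination of all corners -/

/-- The point of `x`, hence also that of `y`, lies in the quadrant of step `st x`, and not at its
vertex because `y ≥ p (st x)`. -/
theorem stage_le_of_le (H : Staging τ w st S) (hw : IsSignedPerm n w) (hτ : IsThetaTriple τ)
    {x y : ℤ} (hx : 1 ≤ x) (hs : st x ≤ τ.s) (hxy : x ≤ y) (hval : w y ≤ w x) : st y ≤ st x := by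
  by_contra h
  have h1 := H.pos_le x hx hs
  have h2 := H.val_le x hx hs
  have := H.avoid hw hτ (x := y) (H.one_le x hx) (by omega) (by omega) (by omega) (by omega)
  omega

theorem stage_lt_of_lt (H : Staging τ w st S) (hw : IsSignedPerm n w) (hτ : IsThetaTriple τ)
    {x y : ℤ} (hx : 1 ≤ x) (hxy : x < y) (hval : w y < w x) : st y < st x := by
  have hne : st x ≠ st y := fun h => by
    have := H.mono x y hx hxy h
    omega
  rcases (H.le x hx).lt_or_eq with h | h
  · have := H.stage_le_of_le hw hτ hx (by omega) hxy.le hval.le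
    omega
  · have := H.le y (by omega)
    omega

/-- The value `-q + 1` was eligible at step `st x`, so its absolute value is used. The value itself
would form an inversion with `x` in the wrong order of steps, so `q - 1` was placed, at a step `l <
a`. If `q - 1` were not the top value `-q l`, then `q` or `-q` would be used by step `l`: the first
contradicts `p ≤ w.symm (-q)`, the second the sign of the entries. -/
theorem exists_q_eq (H : Staging τ w st S) (hw : IsSignedPerm n w) (hτ : IsThetaTriple τ)
    {p q x : ℤ} (hc : IsCornerPos w p q) (hx : p ≤ x) (hs : st x ≤ τ.s) (hval : w x ≤ -q)
    (hlt : -q < -τ.q (st x)) :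
    q < 0 ∧ τ.a ≤ st x ∧ ∃ l, 1 ≤ l ∧ l < τ.a ∧ τ.q l = -q + 1 := by
  obtain ⟨hp, -, -, hz, hy⟩ := (isCornerPos_iff hw p q).1 hc
  have hwy : w (w.symm (-q)) = -q := w.apply_symm_apply _
  have hx1 : 1 ≤ x := by omega
  have hx2 := H.one_le x hx1
  have hq0 : q ≠ 0 := by
    rintro rfl
    have : w.symm (-0) = 0 := by rw [Equiv.symm_apply_eq, hw.map_zero, neg_zero]
    omega
  have hq1 : -q + 1 ≠ 0 := by
    intro h
    have := H.pos_of_a_le hτ hx1 (hτ.a_le_of_q_neg hx2 (by have := hτ.A1 _ hx2 hs; omega))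
    omega
  obtain ⟨y, hy1, h1, -, h2⟩ := H.val_fill_le hx1 hs (u := -q + 1) (by omega) (by omega) hq1
  rcases abs_eq_abs.1 h2 with h2 | h2
  · have hyz : w.symm (-q + 1) = y := by rw [← h2, Equiv.symm_apply_apply]
    have := H.stage_lt_of_lt hw hτ hy1 (y := x) (by omega) (by omega)
    omega
  rcases lt_or_ge (st y) τ.a with hya | hya
  swap
  · have := H.pos_of_a_le hτ hy1 hya
    have := H.pos_of_a_le hτ hx1 (by omega)
    omega
  have hneg := H.neg_of_lt_a hτ hy1 (by omega) hya
  have hxa : τ.a ≤ st x := hτ.a_le_of_q_neg hx2 (by omega)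
  refine ⟨by omega, hxa, st y, H.one_le y hy1, hya, ?_⟩
  have hyv := H.val_le y hy1 (by omega)
  by_contra hne
  obtain ⟨z, hz1, h3, -, h4⟩ := H.val_fill_le hy1 (by omega) (u := q) (by omega) (by omega) hq0
  rcases abs_eq_abs.1 h4 with h4 | h4
  · have : w.symm (-q) = -z := by rw [hw.symm_neg, ← h4, Equiv.symm_apply_apply]
    omega
  · have := H.neg_of_lt_a hτ hz1 (by omega) (by omega)
    omega

/-- A corner position is one of the `(p i, q i)` or lies below one of them in the same column and
in a row opposite to some `q l > 0`. -/
theorem corner_cases (H : Staging τ w st S) (hw : IsSignedPerm n w) (hτ : IsThetaTriple τ)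
    {p q : ℤ} (hc : IsCornerPos w p q) :
    ∃ i, 1 ≤ i ∧ i ≤ τ.s ∧ p = τ.p i ∧ (q = τ.q i ∨ τ.q i < q ∧ q < 0 ∧ τ.a ≤ i ∧
      ∃ l, 1 ≤ l ∧ l < τ.a ∧ τ.q l = -q + 1) := by
  obtain ⟨hp, hwp, hwp', hz, hy⟩ := (isCornerPos_iff hw p q).1 hc
  have hwy : w (w.symm (-q)) = -q := w.apply_symm_apply _
  set y := w.symm (-q) with hydef
  have hy1 : 1 ≤ y := by omega
  have hzero := hw.map_zero
  have hprev : p = 1 ∨ 2 ≤ p ∧ st p < st (p - 1) ∧ st y < st (p - 1) := by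
    rcases eq_or_lt_of_le hp with h | h
    · exact Or.inl h.symm
    · exact Or.inr ⟨h, H.stage_lt_of_lt hw hτ (by omega) (by omega) (by omega),
        H.stage_lt_of_lt hw hτ (by omega) (by omega) (by omega)⟩
  -- For `p ≥ 2`, position `p - 1` is filled after `x`, so step `st x` must start beyond it. For `p
  -- = 1`, the entry `w x` is negative, so `x` is not left to the last step.
  have key : ∀ x, p ≤ x → w x ≤ -q → st x ≤ τ.s ∧ τ.p (st x) ≤ x ∧
      p ≤ τ.p (st x) := by
    intro x hpx hxq
    have hx1 : 1 ≤ x := by omega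
    rcases hprev with h | ⟨h1, -, -⟩
    · have hs : st x ≤ τ.s := by
        by_contra hs
        have := H.last_pos x hx1 (by have := H.le x hx1; omega)
        rw [h, sub_self, hzero] at hwp'
        omega
      have := hτ.p_pos _ (H.one_le x hx1) hs
      exact ⟨hs, H.pos_le x hx1 hs, by omega⟩
    · have h2 := H.stage_lt_of_lt hw hτ (x := p - 1) (y := x) (by omega) (by omega) (by omega)
      have h3 := H.le (p - 1) (by omega)
      have hs : st x ≤ τ.s := by omega
      refine ⟨hs, H.pos_le x hx1 hs, ?_⟩
      by_contra h4
      have := H.pos_fill x (p - 1) (by omega) (by omega) hs (by omega)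
      omega
  obtain ⟨hps, hpe, hpe'⟩ := key p le_rfl hwp
  obtain ⟨hys, hye, hye'⟩ := key y hy hwy.le
  have hyv := H.val_le y hy1 hys
  rcases lt_or_ge (st p) (st y) with h | h
  · have h1 := hτ.p_le (H.one_le p hp) h.le hys
    refine ⟨st y, H.one_le y hy1, hys, by omega, ?_⟩
    rcases eq_or_lt_of_le hyv with h2 | h2
    · left; omega
    · obtain ⟨h3, h4, h5⟩ := H.exists_q_eq hw hτ hc hy hys hwy.le (by omega)
      exact Or.inr ⟨by omega, h3, h4, h5⟩
  · have h1 := hτ.q_le (H.one_le y hy1) h hps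
    refine ⟨st p, H.one_le p hp, hps, by omega, ?_⟩
    rcases eq_or_ne q (τ.q (st p)) with h2 | h2
    · exact Or.inl h2
    · obtain ⟨h3, h4, h5⟩ := H.exists_q_eq hw hτ hc le_rfl hps hwp (by omega)
      exact Or.inr ⟨by omega, h3, h4, h5⟩

/-! ### The northeast path and the decomposition -/

/-- Every corner is some `(p j, q')` with `q' ≥ q j`; a first coordinate above `p i` forces `j < i`,
hence `q' ≥ q`. -/
theorem not_posLT (H : Staging τ w st S) (hw : IsSignedPerm n w) (hτ : IsThetaTriple τ)
    {i : ℕ} {q : ℤ} (hi : 1 ≤ i) (hq : ∀ j, 1 ≤ j → j < i → q ≤ τ.q j)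
    {y : ℤ × ℤ} (hy : IsCornerPos w y.1 y.2) : ¬PosLT y (τ.p i, q) := by
  rintro ⟨h1, h2⟩
  obtain ⟨j, hj, hjs, h3, h4⟩ := H.corner_cases hw hτ hy
  simp only at h1 h2
  have hji : j < i := by
    by_contra h
    have := hτ.p_le hi (j := j) (by omega) hjs
    omega
  have := hq j hj hji
  rcases h4 with h4 | ⟨h4, -⟩ <;> omega

theorem mem_nePath (H : Staging τ w st S) (hw : IsSignedPerm n w) (hτ : IsThetaTriple τ) {i : ℕ}
    (hi : 1 ≤ i) (his : i ≤ τ.s) : (τ.p i, τ.q i) ∈ nePath w :=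
  ⟨H.isCornerPos hw hτ hi his, fun _ hy =>
    H.not_posLT hw hτ hi (fun _ hj hji => hτ.q_le hj hji.le his) hy⟩

theorem cornerSet_eq (H : Staging τ w st S) (hw : IsSignedPerm n w) (hτ : IsThetaTriple τ) :
    cornerSet w = τ.toSet ∪ optional τ w ∪ unessential w := by
  ext ⟨k, p, q⟩
  constructor
  swap
  · rintro ((⟨i, hi, his, h⟩ | h) | h)
    · obtain ⟨rfl, rfl, rfl⟩ : k = τ.k i ∧ p = τ.p i ∧ q = τ.q i := by simpa using h
      exact ⟨H.isCornerPos hw hτ hi his, (H.rank_eq hw hτ hi his).symm⟩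
    · exact h.1
    · exact h.1
  intro ht
  by_cases hmem : ∃ i, 1 ≤ i ∧ i ≤ τ.s ∧ (p, q) = (τ.p i, τ.q i)
  · obtain ⟨i, hi, his, h⟩ := hmem
    obtain ⟨rfl, rfl⟩ : p = τ.p i ∧ q = τ.q i := by simpa using h
    refine Or.inl (Or.inl ⟨i, hi, his, ?_⟩)
    rw [← H.rank_eq hw hτ hi his, ← ht.2]
  push Not at hmem
  obtain ⟨i₀, hi₀, his₀, hp₀, hq₀ | ⟨hq₀, hq, -, l, hl, hla, hql⟩⟩ := H.corner_cases hw hτ ht.1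
  · exact absurd (by simp only at hp₀ hq₀; rw [hp₀, hq₀]) (hmem i₀ hi₀ his₀)
  simp only at hp₀ hq₀ hq hql
  have hex : ∃ i, 1 ≤ i ∧ i ≤ τ.s ∧ p = τ.p i ∧ τ.q i < q := ⟨i₀, hi₀, his₀, hp₀, hq₀⟩
  classical
  -- Minimality of `i` turns `q (i - 1) < q` into `p (i - 1) > p`, so `(p (i - 1), q (i - 1))` is
  -- the strictly smaller path corner of an unessential one.
  obtain ⟨hi, his, hp, hqi⟩ := Nat.find_spec hex
  have hmin := fun m => Nat.find_min hex (m := m)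
  set i := Nat.find hex
  have hia : τ.a ≤ i := hτ.a_le_of_q_neg hi (by omega)
  -- Since `1 ≤ l < a ≤ i`, the index `i - 1` is at least `1` and the meaningless `q 0` does not
  -- occur.
  rcases le_or_gt q (τ.q (i - 1)) with h | h
  · exact Or.inl (Or.inr ⟨ht, hmem, i, l, ⟨hia, his⟩, ⟨hl, hla⟩, hp, hqi, by simp only; omega, h⟩)
  · have h1 : p ≠ τ.p (i - 1) := fun h2 =>
      hmin (i - 1) (by omega) ⟨by omega, by omega, h2, h⟩
    have h2 := hτ.p_le (i := i - 1) (j := i) (by omega) (by omega) his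
    exact Or.inr ⟨ht, _, H.mem_nePath hw hτ hi his, _, H.mem_nePath hw hτ hl (by omega),
      _, H.mem_nePath hw hτ (i := i - 1) (by omega) (by omega),
      ⟨hp.symm, hqi, hq⟩, ⟨hτ.p_pos l hl (by omega), hql⟩, by simp only; omega, h⟩

theorem disjoint_unessential (H : Staging τ w st S) (hw : IsSignedPerm n w)
    (hτ : IsThetaTriple τ) : Disjoint (τ.toSet ∪ optional τ w) (unessential w) := by
  rw [Set.disjoint_left]
  rintro ⟨k, p, q⟩ (⟨i, hi, his, h⟩ | ⟨-, -, i, j, ⟨hia, his⟩, ⟨hj, hja⟩, rfl, hqi, -, hq⟩)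
    ⟨-, _, -, _, -, x, hx, -, -, hlt⟩
  · obtain ⟨rfl, rfl, rfl⟩ : k = τ.k i ∧ p = τ.p i ∧ q = τ.q i := by simpa using h
    exact (H.mem_nePath hw hτ hi his).2 x hx.1 hlt
  · refine H.not_posLT hw hτ (by omega) (fun m hm hmi => ?_) hx.1 hlt
    have := hτ.q_le hm (j := i - 1) (by omega) (by omega)
    simp only at hq ⊢
    omega

end Staging

theorem disjoint_toSet_optional (τ : TripleSeq) (w : Equiv.Perm ℤ) :
    Disjoint τ.toSet (optional τ w) := by
  rw [Set.disjoint_left]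
  rintro _ ⟨i, hi, his, rfl⟩ ⟨-, h, -⟩
  exact h i hi his rfl

/-! ### The construction of `w(τ)` proceeds in stages -/

theorem exists_bound (P : List (ℤ × ℤ)) :
    ∃ M : ℕ, ∀ e ∈ P, e.1.natAbs < M ∧ e.2.natAbs < M := by
  induction P with
  | nil => exact ⟨0, by simp⟩
  | cons e P ih =>
    obtain ⟨M, hM⟩ := ih
    refine ⟨M + e.1.natAbs + e.2.natAbs + 1, fun e' he' => ?_⟩
    rcases List.mem_cons.1 he' with rfl | he'
    · omega
    · have := hM e' he'
      omega

/-- With infinitely many candidates, `Nat.nth` is strictly increasing and never takes its default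
value `0`. -/
theorem infinite_setOf_posFree (P : List (ℤ × ℤ)) (p : ℤ) :
    {t : ℕ | PosFree P (p + t)}.Infinite := by
  obtain ⟨M, hM⟩ := exists_bound P
  refine Set.infinite_of_forall_exists_gt fun N => ⟨N + M + p.natAbs + 1, ?_, by omega⟩
  intro e he h
  have := (hM e he).1
  omega

theorem infinite_setOf_valFree_sub (P : List (ℤ × ℤ)) (q : ℤ) :
    {t : ℕ | ValFree P (-q - t)}.Infinite := by
  obtain ⟨M, hM⟩ := exists_bound P
  refine Set.infinite_of_forall_exists_gt fun N =>
    ⟨N + M + q.natAbs + 1, ⟨by omega, ?_⟩, by omega⟩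
  intro e he h
  have := (hM e he).2
  rw [Int.abs_eq_natAbs, Int.abs_eq_natAbs] at h
  omega

theorem infinite_setOf_valFree (P : List (ℤ × ℤ)) :
    {x : ℕ | ValFree P x}.Infinite := by
  obtain ⟨M, hM⟩ := exists_bound P
  refine Set.infinite_of_forall_exists_gt fun N =>
    ⟨N + M + 1, ⟨by omega, ?_⟩, by omega⟩
  intro e he h
  have := (hM e he).2
  rw [Int.abs_eq_natAbs, Int.abs_eq_natAbs] at h
  omega

theorem mem_step {P : List (ℤ × ℤ)} {m : ℕ} {p q : ℤ} {e : ℤ × ℤ} :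
    e ∈ step P m p q ↔ e ∈ P ∨ ∃ j < m,
      e = (p + (Nat.nth (fun t : ℕ => PosFree P (p + t)) j : ℤ),
        -q - (Nat.nth (fun t : ℕ => ValFree P (-q - t)) (m - 1 - j) : ℤ)) := by
  simp only [step, List.mem_append, List.mem_map, List.mem_range, eq_comm (a := e)]

theorem not_posFree_iff {P : List (ℤ × ℤ)} {x : ℤ} : ¬PosFree P x ↔ ∃ e ∈ P, e.1 = x := by
  simp [PosFree]

theorem posFree_nth (P : List (ℤ × ℤ)) (p : ℤ) (j : ℕ) :
    PosFree P (p + (Nat.nth (fun t : ℕ => PosFree P (p + t)) j : ℤ)) :=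
  Nat.nth_mem_of_infinite (infinite_setOf_posFree P p) j

theorem placed_mono (τ : TripleSeq) {i j : ℕ} (hij : i ≤ j) : placed τ i ⊆ placed τ j := by
  induction j, hij using Nat.le_induction with
  | base => exact fun _ h => h
  | succ j hij ih => exact fun e he => mem_step.2 (Or.inl (ih he))

theorem nodup_placed (τ : TripleSeq) (i : ℕ) : ((placed τ i).map Prod.fst).Nodup := by
  induction i with
  | zero => simp [placed]
  | succ i ih =>
    rw [placed, step, List.map_append, List.nodup_append']
    refine ⟨ih, ?_, ?_⟩
    · rw [List.map_map]
      refine List.Nodup.map (fun j j' h => ?_) List.nodup_range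
      refine Nat.nth_injective (infinite_setOf_posFree (placed τ i) (τ.p (i + 1))) ?_
      simpa using h
    · intro x hx hx'
      obtain ⟨e, he, rfl⟩ := List.mem_map.1 hx
      rw [List.map_map] at hx'
      obtain ⟨j, -, hj⟩ := List.mem_map.1 hx'
      exact posFree_nth _ _ j e he hj.symm

theorem length_placed {τ : TripleSeq} (hτ : IsThetaTriple τ) {i : ℕ} (hi : i ≤ τ.s) :
    (placed τ i).length = τ.k i := by
  induction i with
  | zero => simp [placed, hτ.k_zero]
  | succ i ih =>
    have := hτ.k_lt i (by omega)
    rw [placed, step, List.length_append, ih (by omega), List.length_map, List.length_range]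
    omega

theorem p_le_of_mem_placed {τ : TripleSeq} (hτ : IsThetaTriple τ) {i : ℕ} (hi : i ≤ τ.s)
    {e : ℤ × ℤ} (he : e ∈ placed τ i) : τ.p i ≤ e.1 := by
  induction i with
  | zero => simp [placed] at he
  | succ i ih =>
    rcases mem_step.1 he with he | ⟨j, -, rfl⟩
    · rcases Nat.eq_zero_or_pos i with rfl | h
      · simp [placed] at he
      · have := ih (by omega) he
        have := hτ.p_anti i h (by omega)
        omega
    · simp only
      omega

theorem one_le_of_mem_placed {τ : TripleSeq} (hτ : IsThetaTriple τ) {i : ℕ} (hi : i ≤ τ.s)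
    {e : ℤ × ℤ} (he : e ∈ placed τ i) : 1 ≤ e.1 := by
  have h1 := p_le_of_mem_placed hτ hi he
  rcases Nat.eq_zero_or_pos i with rfl | h
  · simp [placed] at he
  · have := hτ.p_pos i h hi
    omega

theorem lookup_eq_some_of_mem {P : List (ℤ × ℤ)} (hP : (P.map Prod.fst).Nodup) {e : ℤ × ℤ}
    (he : e ∈ P) : P.lookup e.1 = some e.2 := by
  obtain ⟨l₁, l₂, rfl⟩ := List.append_of_mem he
  refine List.lookup_eq_some_iff.2 ⟨l₁, l₂, rfl, fun e' he' => ?_⟩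
  rw [List.map_append, List.nodup_append'] at hP
  rw [bne_iff_ne]
  intro h
  exact hP.2.2 (List.mem_map_of_mem he') (by rw [← h]; simp)

theorem IsPermOf.apply_of_mem {τ : TripleSeq} {w : Equiv.Perm ℤ} (h : IsPermOf τ w)
    (hτ : IsThetaTriple τ) {i : ℕ} (hi : i ≤ τ.s) {e : ℤ × ℤ} (he : e ∈ placed τ i) :
    w e.1 = e.2 := by
  have h1 := one_le_of_mem_placed hτ hi he
  have h2 := h e.1.toNat (by omega)
  have h3 : ((e.1.toNat : ℕ) : ℤ) = e.1 := by omega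
  rw [entry, h3, lookup_eq_some_of_mem (nodup_placed τ τ.s) (placed_mono τ hi he),
    Option.getD_some] at h2
  exact h2

theorem IsPermOf.apply_of_posFree {τ : TripleSeq} {w : Equiv.Perm ℤ} (h : IsPermOf τ w) {z : ℕ}
    (hz : 1 ≤ z) (hfree : PosFree (placed τ τ.s) z) :
    w z = entry τ z ∧ (placed τ τ.s).lookup (z : ℤ) = none := by
  refine ⟨h z hz, List.lookup_eq_none_iff.2 fun e he => ?_⟩
  rw [bne_iff_ne]
  exact (hfree e he).symm

open Classical in
/-- The step of the construction of `w(τ)` at which the position `x` is filled. -/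
noncomputable def stage (τ : TripleSeq) (x : ℤ) : ℕ :=
  Nat.find (p := fun i => i = τ.s + 1 ∨ ¬PosFree (placed τ i) x) ⟨_, Or.inl rfl⟩

theorem stage_le_iff {τ : TripleSeq} {x : ℤ} {i : ℕ} (hi : i ≤ τ.s) :
    stage τ x ≤ i ↔ ∃ e ∈ placed τ i, e.1 = x := by
  classical
  rw [stage, Nat.find_le_iff]
  constructor
  · rintro ⟨j, hj, rfl | h⟩
    · omega
    · obtain ⟨e, he, hx⟩ := not_posFree_iff.1 h
      exact ⟨e, placed_mono τ hj he, hx⟩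
  · intro h
    exact ⟨i, le_rfl, Or.inr (not_posFree_iff.2 h)⟩

theorem lt_stage_iff {τ : TripleSeq} {x : ℤ} {i : ℕ} (hi : i ≤ τ.s) :
    i < stage τ x ↔ PosFree (placed τ i) x := by
  rw [← not_le, stage_le_iff hi, ← not_posFree_iff, not_not]

theorem stage_le (τ : TripleSeq) (x : ℤ) : stage τ x ≤ τ.s + 1 := by
  classical
  exact Nat.find_min' _ (Or.inl rfl)

theorem one_le_stage (τ : TripleSeq) (x : ℤ) : 1 ≤ stage τ x :=
  (lt_stage_iff (Nat.zero_le _)).2 (by simp [placed, PosFree])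

theorem exists_of_stage_eq {τ : TripleSeq} {w : Equiv.Perm ℤ} (hτ : IsThetaTriple τ)
    (h : IsPermOf τ w) {x : ℤ} {i : ℕ} (hi : i < τ.s) (hx : stage τ x = i + 1) :
    ∃ j < τ.k (i + 1) - τ.k i,
      x = τ.p (i + 1) + (Nat.nth (fun t : ℕ => PosFree (placed τ i) (τ.p (i + 1) + t)) j : ℤ) ∧
      w x = -τ.q (i + 1) - (Nat.nth (fun t : ℕ => ValFree (placed τ i) (-τ.q (i + 1) - t))
        (τ.k (i + 1) - τ.k i - 1 - j) : ℤ) := by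
  obtain ⟨e, he, rfl⟩ := (stage_le_iff (i := i + 1) hi).1 hx.le
  rw [h.apply_of_mem hτ (i := i + 1) hi he]
  rcases mem_step.1 he with he | ⟨j, hj, rfl⟩
  · exact absurd rfl ((lt_stage_iff hi.le).1 (by omega) e he)
  · exact ⟨j, hj, rfl, rfl⟩

theorem exists_stage_eq_of_lt {τ : TripleSeq} {w : Equiv.Perm ℤ} (hτ : IsThetaTriple τ)
    (h : IsPermOf τ w) {i j : ℕ} (hi : i < τ.s) (hj : j < τ.k (i + 1) - τ.k i) {x : ℤ}
    (hx : x = τ.p (i + 1) +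
      (Nat.nth (fun t : ℕ => PosFree (placed τ i) (τ.p (i + 1) + t)) j : ℤ)) :
    1 ≤ x ∧ stage τ x = i + 1 ∧
      w x = -τ.q (i + 1) - (Nat.nth (fun t : ℕ => ValFree (placed τ i) (-τ.q (i + 1) - t))
        (τ.k (i + 1) - τ.k i - 1 - j) : ℤ) := by
  have hmem : (x, -τ.q (i + 1) - (Nat.nth (fun t : ℕ => ValFree (placed τ i) (-τ.q (i + 1) - t))
      (τ.k (i + 1) - τ.k i - 1 - j) : ℤ)) ∈ placed τ (i + 1) :=
    mem_step.2 (Or.inr ⟨j, hj, by rw [hx]⟩)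
  have h1 := (lt_stage_iff hi.le).2 (posFree_nth (placed τ i) (τ.p (i + 1)) j)
  have h2 := (stage_le_iff (i := i + 1) hi).2 ⟨_, hmem, rfl⟩
  rw [← hx] at h1
  simp only at h2
  exact ⟨one_le_of_mem_placed hτ (i := i + 1) hi hmem, by omega,
    h.apply_of_mem hτ (i := i + 1) hi hmem⟩

theorem exists_nth_eq {P : ℕ → Prop} {t : ℕ} (ht : P t) : ∃ c, Nat.nth P c = t := by
  classical
  exact ⟨Nat.count P t, Nat.nth_count ht⟩

open Classical in
theorem apply_of_last_stage {τ : TripleSeq} {w : Equiv.Perm ℤ} (h : IsPermOf τ w) {x : ℤ}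
    (hx : 1 ≤ x) (hs : stage τ x = τ.s + 1) :
    PosFree (placed τ τ.s) x ∧ w x = (Nat.nth (fun x : ℕ => ValFree (placed τ τ.s) x)
      (Nat.count (fun y : ℕ => 1 ≤ y ∧ PosFree (placed τ τ.s) y) x.toNat) : ℤ) := by
  have hfree : PosFree (placed τ τ.s) x := (lt_stage_iff le_rfl).1 (by omega)
  lift x to ℕ using by omega
  obtain ⟨h1, h2⟩ := h.apply_of_posFree (by omega) hfree
  rw [entry, h2, Option.getD_none] at h1
  refine ⟨hfree, h1.trans ?_⟩
  rw [Int.toNat_natCast]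

theorem staging {τ : TripleSeq} {w : Equiv.Perm ℤ} (hτ : IsThetaTriple τ) (h : IsPermOf τ w) :
    Staging τ w (stage τ) (fun i => ((placed τ i).map Prod.fst).toFinset) where
  one_le x _ := one_le_stage τ x
  le x _ := stage_le τ x
  mem i hi x := by
    rw [stage_le_iff hi, List.mem_toFinset, List.mem_map]
    constructor
    · rintro ⟨e, he, rfl⟩
      exact ⟨one_le_of_mem_placed hτ hi he, e, he, rfl⟩
    · exact fun hx => hx.2
  card i hi := by
    rw [List.toFinset_card_of_nodup (nodup_placed τ i), List.length_map, length_placed hτ hi]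
  pos_le x _ hs := by
    obtain ⟨i, hi⟩ := Nat.exists_eq_add_of_le' (one_le_stage τ x)
    obtain ⟨j, -, hj, -⟩ := exists_of_stage_eq hτ h (by omega) hi
    rw [hi]
    omega
  val_le x _ hs := by
    obtain ⟨i, hi⟩ := Nat.exists_eq_add_of_le' (one_le_stage τ x)
    obtain ⟨j, -, -, hj⟩ := exists_of_stage_eq hτ h (by omega) hi
    rw [hi]
    omega
  mono x y hx hxy hst := by
    classical
    obtain ⟨i, hi⟩ := Nat.exists_eq_add_of_le' (one_le_stage τ x)
    have hle := stage_le τ x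
    rcases lt_or_ge i τ.s with his | his
    · obtain ⟨j, hj, h1, h2⟩ := exists_of_stage_eq hτ h his hi
      obtain ⟨j', hj', h3, h4⟩ := exists_of_stage_eq hτ h his (hst ▸ hi)
      have hlt : j < j' := (Nat.nth_lt_nth (infinite_setOf_posFree (placed τ i) (τ.p (i + 1)))).1
        (by rw [h1, h3] at hxy; omega)
      -- Values are enumerated downwards with a reversed index; the two reversals cancel.
      have := (Nat.nth_lt_nth (infinite_setOf_valFree_sub (placed τ i) (τ.q (i + 1)))).2
        (show τ.k (i + 1) - τ.k i - 1 - j' < τ.k (i + 1) - τ.k i - 1 - j by omega)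
      omega
    · obtain ⟨h1, h2⟩ := apply_of_last_stage h hx (by omega)
      obtain ⟨h3, h4⟩ := apply_of_last_stage h (x := y) (by omega) (by omega)
      rw [h2, h4, Int.ofNat_lt]
      refine (Nat.nth_lt_nth (infinite_setOf_valFree _)).2 ?_
      refine Nat.count_strict_mono ⟨by omega, ?_⟩ (by omega)
      rwa [Int.toNat_of_nonneg (by omega)]
  pos_fill x y hy hyx hs hpy := by
    obtain ⟨i, hi⟩ := Nat.exists_eq_add_of_le' (one_le_stage τ x)
    rw [hi] at hpy ⊢
    obtain ⟨j, hj, h1, -⟩ := exists_of_stage_eq hτ h (by omega) hi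
    by_contra hlt
    have hfree : PosFree (placed τ i) y := (lt_stage_iff (by omega)).1 (by omega)
    have hyt : y = τ.p (i + 1) + ((y - τ.p (i + 1)).toNat : ℕ) := by omega
    obtain ⟨c, hc⟩ := exists_nth_eq (P := fun t : ℕ => PosFree (placed τ i) (τ.p (i + 1) + t)) (hyt ▸ hfree)
    have hcj : c < j := (Nat.nth_lt_nth (infinite_setOf_posFree (placed τ i) (τ.p (i + 1)))).1
      (by rw [hc]; omega)
    have := (exists_stage_eq_of_lt hτ h (i := i) (j := c) (x := y) (by omega) (by omega)
      (hc.symm ▸ hyt)).2.1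
    omega
  val_fill x u hx hs hxu huq hu := by
    obtain ⟨i, hi⟩ := Nat.exists_eq_add_of_le' (one_le_stage τ x)
    rw [hi] at huq ⊢
    obtain ⟨j, hj, -, h1⟩ := exists_of_stage_eq hτ h (by omega) hi
    by_cases hfree : ValFree (placed τ i) u
    · have hut : u = -τ.q (i + 1) - ((-τ.q (i + 1) - u).toNat : ℕ) := by omega
      rw [hut] at hfree
      obtain ⟨c, hc⟩ :=
        exists_nth_eq (P := fun t : ℕ => ValFree (placed τ i) (-τ.q (i + 1) - t)) hfree
      have hcj : c < τ.k (i + 1) - τ.k i - 1 - j :=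
        (Nat.nth_lt_nth (infinite_setOf_valFree_sub (placed τ i) (τ.q (i + 1)))).1
          (by rw [hc]; omega)
      -- The value with `c` eligible values above it goes to the position with `c` positions of this
      -- step after it.
      obtain ⟨h2, h3, h4⟩ := exists_stage_eq_of_lt hτ h (i := i)
        (j := τ.k (i + 1) - τ.k i - 1 - c) (by omega) (by omega) rfl
      refine ⟨_, h2, Or.inl ⟨h3, ?_⟩⟩
      rw [h4, Nat.sub_sub_self (by omega), hc, ← hut]
    · obtain ⟨e, he, h2⟩ : ∃ e ∈ placed τ i, |e.2| = |u| := by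
        simpa [ValFree, hu] using hfree
      refine ⟨e.1, one_le_of_mem_placed hτ (by omega) he, Or.inr ⟨?_, ?_⟩⟩
      · have := (stage_le_iff (τ := τ) (i := i) (by omega)).2 ⟨e, he, rfl⟩
        omega
      · rw [h.apply_of_mem hτ (by omega) he, h2]
  last_pos x hx hs := by
    classical
    rw [(apply_of_last_stage h hx hs).2]
    have := (Nat.nth_mem_of_infinite (infinite_setOf_valFree (placed τ τ.s))
      (Nat.count (fun y : ℕ => 1 ≤ y ∧ PosFree (placed τ τ.s) y) x.toNat)).1
    omega

end ThetaVex

theorem mainTheorem3 (n : ℕ) (w : Equiv.Perm ℤ) (hw : ThetaVex.IsSignedPerm n w)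
    (τ : ThetaVex.TripleSeq) (hτ : ThetaVex.IsThetaTriple τ) (hwτ : ThetaVex.IsPermOf τ w) :
    ThetaVex.cornerSet w = τ.toSet ∪ ThetaVex.optional τ w ∪ ThetaVex.unessential w ∧
      Disjoint τ.toSet (ThetaVex.optional τ w) ∧
      Disjoint τ.toSet (ThetaVex.unessential w) ∧
      Disjoint (ThetaVex.optional τ w) (ThetaVex.unessential w) := by
  have H := ThetaVex.staging hτ hwτ
  have hU := Set.disjoint_union_left.1 (H.disjoint_unessential hw hτ)
  exact ⟨H.cornerSet_eq hw hτ, ThetaVex.disjoint_toSet_optional τ w, hU.1, hU.2⟩
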